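/- Let $G$ be a group, let $X$ be a set of unknowns and let $W=\{w_i=1\}_{i\in I}$, $w_i\in G*F(X)$, be a system of equations over $G$, where $X$ and $I$ may be infinite. The system is solvable over $G$ if there are a group $H\supseteq G$ and elements $(h_x)_{x\in X}$ of $H$ whose substitution for the unknowns turns all the $w_i$ into $1$. It is nonsingular if the family of integer rows formed by the exponent sums of the unknowns in the equations is linearly independent (over $\mathbb Z$). $G$ is called a GR-group if every nonsingular (possibly infinite) system of equations over $G$ is solvable over $G$. Let $\varepsilon\colon G*F(X)\to F(X)$ be the content homomorphism, which is trivial on $G$ and is the identity on $F(X)$, and consider the presentation $P=\langle X\mid \varepsilon(w_i),\ i\in I\rangle$, with one relator for each $i\in I$ (repetitions and trivial relators are kept). Write $\Gamma$ for the group given by $P$ and $\pi\colon F(X)\to\Gamma$ for the natural epimorphism. For a subgroup $U\le\Gamma$, a Schreier system for $U$ is a prefix-closed set $T\subseteq F(X)$ of reduced words containing exactly one representative $\overline v$ of each right coset $\pi^{-1}(U)v$. The corresponding Schreier presentation of $U$ has as generators the nontrivial elements $y_{t,x}=tx\,\overline{tx}^{\,-1}$ ($t\in T$, $x\in X$), and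 as relators the family of all elements $t\,\varepsilon(w_i)\,t^{-1}$ ($t\in T$, $i\in I$, one relator for each pair $(t,i)$), rewritten as words in these generators. The standard complex of $P$ is the two-dimensional cell complex with one vertex, one edge for each $x\in X$ and one 2-cell for each $i\in I$, glued along the word $\varepsilon(w_i)$. Coverings are understood to be surjective (equivalently here, nonempty). **Theorem (Nitsche–Thom).** The following conditions on $P$ are equivalent: 1. some subgroup $U\le\Gamma$ has a Schreier presentation (for some Schreier system $T$) whose relators form a nonsingular system; 2. the standard complex of $P$ admits a covering $\widetilde K$ with $H_2(\widetilde K;\mathbb Z)=0$; 3. the standard complex of $P$ admits a connected covering $\widetilde K$ with $H_2(\widetilde K;\mathbb Z)=0$. If $G$ is a GR-group and these equivalent conditions hold, then the system $W$ is solvable over $G$. -/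

import Mathlib

universe u v

/-! ### Systems of equations over groups -/

/-- A system of equations `w i = 1` (`i : I`) over the group `G` with unknowns `X`; its left-hand
sides are elements of the free product `G * F(X)`. Both `X` and `I` may be infinite. -/
abbrev EqSystem (G : Type u) [Group G] (X I : Type v) : Type (max u v) :=
  I → Monoid.Coprod G (FreeGroup X)

/-- The system is solvable over `G`: there are an overgroup `H` of `G` (given by an injective
homomorphism `φ : G →* H`) and elements `s x` of `H` whose substitution for the unknowns turns
every equation into a true equality. -/
def EqSystem.SolvableOver {G : Type u} [Group G] {X I : Type v} (w : EqSystem G X I) : Prop :=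
  ∃ (H : Type (max u v)) (_ : Group H) (φ : G →* H) (s : X → H), Function.Injective φ ∧
    ∀ i, Monoid.Coprod.lift φ (FreeGroup.lift s) (w i) = 1

/-- The content `ε : G * F(X) → F(X)`: it kills `G` and is the identity on `F(X)`. -/
def content (G : Type u) [Group G] (X : Type v) :
    Monoid.Coprod G (FreeGroup X) →* FreeGroup X :=
  Monoid.Coprod.lift 1 (MonoidHom.id (FreeGroup X))

/-- The row of exponent sums of an element of a free group. -/
noncomputable def exponentSums {X : Type v} (r : FreeGroup X) : X →₀ ℤ :=
  Multiplicative.toAdd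
    (FreeGroup.lift (fun x : X => Multiplicative.ofAdd (Finsupp.single x (1 : ℤ))) r)

/-- A family of elements of a free group (that is, a system of equations without coefficients) is
nonsingular if the rows of exponent sums of its members are linearly independent; the rows form a
family, so that two members with equal rows make the system singular. -/
def NonsingularFamily {X I : Type v} (r : I → FreeGroup X) : Prop :=
  LinearIndependent ℤ (fun i => exponentSums (r i))

/-- A system of equations is nonsingular if the rows of exponent sums of the unknowns are linearly
independent. -/
def EqSystem.Nonsingular {G : Type u} [Group G] {X I : Type v} (w : EqSystem G X I) : Prop :=
  NonsingularFamily (fun i => content G X (w i))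

/-- `G` is a GR-group: every nonsingular system of equations over `G` is solvable over `G`. -/
def IsGRGroup (G : Type u) [Group G] : Prop :=
  ∀ (X I : Type v) (w : EqSystem G X I), w.Nonsingular → w.SolvableOver

/-! ### Schreier presentations of subgroups -/

open Classical in
/-- A Schreier system of representatives of the right cosets `N g` of a subgroup `N` of `F(X)`. -/
structure SchreierSystem {X : Type v} (N : Subgroup (FreeGroup X)) where
  /-- The set of representatives. -/
  carrier : Set (FreeGroup X)
  /-- Every element of `F(X)` is uniquely `n * t` with `n ∈ N` and `t` a representative. -/
  isComplement : Subgroup.IsComplement (N : Set (FreeGroup X)) carrier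
  /-- Every prefix of the reduced word of a representative is a representative. -/
  prefix_mem : ∀ t ∈ carrier, ∀ l : List (X × Bool), l <+: t.toWord → FreeGroup.mk l ∈ carrier

namespace SchreierSystem

variable {X : Type v} {N : Subgroup (FreeGroup X)} (T : SchreierSystem N)

/-- The representative of the right coset `N g`. -/
noncomputable def rep (g : FreeGroup X) : T.carrier :=
  T.isComplement.toRightFun g

/-- The word `t * x * (rep (t * x))⁻¹`. -/
noncomputable def genWord (p : T.carrier × X) : FreeGroup X :=
  p.1 * FreeGroup.of p.2 * (T.rep (p.1 * FreeGroup.of p.2) : FreeGroup X)⁻¹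

/-- The generators of the Schreier presentation: the nontrivial words `genWord (t, x)`. -/
abbrev Gen : Type v :=
  {p : T.carrier × X // T.genWord p ≠ 1}

open Classical in
/-- The word `genWord (t, x)` as a letter of the alphabet `Gen` if it is nontrivial, and `1`
otherwise. -/
noncomputable def letter (p : T.carrier × X) : FreeGroup T.Gen :=
  if h : T.genWord p ≠ 1 then FreeGroup.of (⟨p, h⟩ : T.Gen) else 1

/-- The rewriting process: reading a word in `X` from left to right, starting at the coset of the
representative `t`, each letter is replaced by the corresponding generator, and the current
representative is updated. -/
noncomputable def rewriteFrom : T.carrier → List (X × Bool) → FreeGroup T.Gen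
  | _, [] => 1
  | t, (x, true) :: l => T.letter (t, x) * rewriteFrom (T.rep (t * FreeGroup.of x)) l
  | t, (x, false) :: l =>
      (T.letter (T.rep (t * (FreeGroup.of x)⁻¹), x))⁻¹ *
        rewriteFrom (T.rep (t * (FreeGroup.of x)⁻¹)) l

open Classical in
/-- An element of `N`, rewritten as a word in the generators `Gen`. -/
noncomputable def rewrite (g : FreeGroup X) : FreeGroup T.Gen :=
  T.rewriteFrom (T.rep 1) g.toWord

theorem mul_rep_inv_mem (g : FreeGroup X) : g * (T.rep g : FreeGroup X)⁻¹ ∈ N :=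
  T.isComplement.mul_inv_toRightFun_mem g

theorem rep_eq_of_mul_inv_mem {g h : FreeGroup X} (H : g * h⁻¹ ∈ N) : T.rep g = T.rep h := by
  refine (Subgroup.isComplement_iff_existsUnique_mul_inv_mem.mp T.isComplement g).unique
    (T.mul_rep_inv_mem g) ?_
  have := N.mul_mem H (T.mul_rep_inv_mem h)
  simpa [mul_assoc] using this

theorem rep_coe (t : T.carrier) : T.rep (t : FreeGroup X) = t :=
  (Subgroup.isComplement_iff_existsUnique_mul_inv_mem.mp T.isComplement (t : FreeGroup X)).unique
    (T.mul_rep_inv_mem t) (by simp)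

theorem lift_letter (p : T.carrier × X) :
    FreeGroup.lift (fun y : T.Gen => T.genWord y.1) (T.letter p) = T.genWord p := by
  unfold letter
  split_ifs with h
  · simp
  · simpa using (not_not.mp h).symm

theorem rep_rep_mul (g h : FreeGroup X) : T.rep ((T.rep g : FreeGroup X) * h) = T.rep (g * h) := by
  refine (T.rep_eq_of_mul_inv_mem ?_).symm
  simpa [mul_assoc] using T.mul_rep_inv_mem g

theorem lift_rewriteFrom (l : List (X × Bool)) (t : T.carrier) :
    FreeGroup.lift (fun y : T.Gen => T.genWord y.1) (T.rewriteFrom t l) =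
      t * FreeGroup.mk l * (T.rep (t * FreeGroup.mk l) : FreeGroup X)⁻¹ := by
  induction l generalizing t with
  | nil => simp [rewriteFrom, ← FreeGroup.one_eq_mk, T.rep_coe]
  | cons a l ih =>
    obtain ⟨x, b⟩ := a
    have hcons : FreeGroup.mk ((x, b) :: l) = FreeGroup.mk [(x, b)] * FreeGroup.mk l := by
      simp [FreeGroup.mul_mk]
    cases b with
    | true =>
      have hx : FreeGroup.mk [(x, true)] = FreeGroup.of x := rfl
      rw [rewriteFrom, map_mul, ih, T.lift_letter, hcons, hx, T.rep_rep_mul]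
      simp [genWord, mul_assoc]
    | false =>
      have hx : FreeGroup.mk [(x, false)] = (FreeGroup.of x)⁻¹ := by
        simp [FreeGroup.of, FreeGroup.inv_mk, FreeGroup.invRev]
      rw [rewriteFrom, map_mul, map_inv, ih, T.lift_letter, hcons, hx, T.rep_rep_mul]
      have h2 : T.rep ((T.rep (t * (FreeGroup.of x)⁻¹) : FreeGroup X) * FreeGroup.of x) = t := by
        rw [T.rep_rep_mul]
        simp [T.rep_coe]
      simp [genWord, h2, mul_assoc]

theorem one_mem : (1 : FreeGroup X) ∈ T.carrier := by
  have := T.prefix_mem (T.rep 1) (T.rep 1).2 [] (List.nil_prefix)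
  simpa [FreeGroup.one_eq_mk] using this

/-- The rewriting process is correct: for `g ∈ N`, the word `rewrite g` represents `g`. -/
theorem lift_rewrite {g : FreeGroup X} (hg : g ∈ N) :
    FreeGroup.lift (fun y : T.Gen => T.genWord y.1) (T.rewrite g) = g := by
  classical
  have h1 : T.rep 1 = ⟨1, T.one_mem⟩ := T.rep_coe ⟨1, T.one_mem⟩
  have hg1 : T.rep g = T.rep 1 := T.rep_eq_of_mul_inv_mem (by simpa using hg)
  unfold rewrite
  rw [lift_rewriteFrom, FreeGroup.mk_toWord, T.rep_rep_mul, one_mul, hg1, h1]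
  simp

end SchreierSystem

/-- The relators of the Schreier presentation of a subgroup of `⟨X | R⟩` with respect to `T`: the
elements `t * R i * t⁻¹`, rewritten in the generators. There is one relator for each pair
`(t, i)`. -/
noncomputable def schreierRelators {X I : Type v} (R : I → FreeGroup X)
    {U : Subgroup (PresentedGroup (Set.range R))}
    (T : SchreierSystem (U.comap (PresentedGroup.mk (Set.range R)))) :
    T.carrier × I → FreeGroup T.Gen :=
  fun p => T.rewrite (p.1 * R p.2 * (p.1 : FreeGroup X)⁻¹)

/-- Some subgroup of the group `⟨X | R⟩` has a Schreier presentation whose relators form a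
nonsingular system. -/
def HasNonsingularSchreierPresentation {X I : Type v} (R : I → FreeGroup X) : Prop :=
  ∃ (U : Subgroup (PresentedGroup (Set.range R)))
    (T : SchreierSystem (U.comap (PresentedGroup.mk (Set.range R)))),
    NonsingularFamily (schreierRelators R T)

/-! ### Two-dimensional complexes and their coverings -/

/-- The word `l` in the oriented edges (`(e, true)` is `e`, and `(e, false)` is `e` traversed
backwards) is a path from `a` to `b`. -/
def IsEdgePath {V E : Type v} (src tgt : E → V) : V → List (E × Bool) → V → Prop
  | a, [], b => a = b
  | a, (e, true) :: l, b => src e = a ∧ IsEdgePath src tgt (tgt e) l b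
  | a, (e, false) :: l, b => tgt e = a ∧ IsEdgePath src tgt (src e) l b

/-- A (combinatorial) two-dimensional cell complex: a graph, whose edges are given with an
orientation, with 2-cells glued along closed edge paths. For each 2-cell, a starting point and a
direction of its boundary path are fixed; the boundary path may be constant. -/
structure TwoComplex where
  /-- The 0-cells. -/
  Vertex : Type v
  /-- The 1-cells. -/
  Edge : Type v
  /-- The 2-cells. -/
  Face : Type v
  /-- The origin of an edge. -/
  src : Edge → Vertex
  /-- The end of an edge. -/
  tgt : Edge → Vertex
  /-- The starting point of the boundary path of a 2-cell. -/
  base : Face → Vertex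
  /-- The boundary path of a 2-cell. -/
  bdry : Face → List (Edge × Bool)
  bdry_closed : ∀ c, IsEdgePath src tgt (base c) (bdry c) (base c)

namespace TwoComplex

/-- Any two vertices are joined by a path, and there is at least one vertex. -/
def Connected (K : TwoComplex.{v}) : Prop :=
  Nonempty K.Vertex ∧ ∀ a b : K.Vertex, ∃ l, IsEdgePath K.src K.tgt a l b

/-- The first cellular boundary map `C₁ → C₀`. -/
noncomputable def boundary₁ (K : TwoComplex.{v}) : (K.Edge →₀ ℤ) →ₗ[ℤ] (K.Vertex →₀ ℤ) :=
  Finsupp.linearCombination ℤ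
    (fun e => Finsupp.single (K.tgt e) (1 : ℤ) - Finsupp.single (K.src e) (1 : ℤ))

/-- The 1-chain of an edge word. -/
noncomputable def chainOfWord {E : Type v} (l : List (E × Bool)) : E →₀ ℤ :=
  (l.map (fun p => Finsupp.single p.1 (if p.2 then (1 : ℤ) else -1))).sum

/-- The second cellular boundary map `C₂ → C₁`. -/
noncomputable def boundary₂ (K : TwoComplex.{v}) : (K.Face →₀ ℤ) →ₗ[ℤ] (K.Edge →₀ ℤ) :=
  Finsupp.linearCombination ℤ (fun c => chainOfWord (K.bdry c))

/-- The cellular chain complex is a complex. -/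
theorem boundary₁_comp_boundary₂ (K : TwoComplex.{v}) : K.boundary₁ ∘ₗ K.boundary₂ = 0 := by
  have key : ∀ (l : List (K.Edge × Bool)) (a b : K.Vertex), IsEdgePath K.src K.tgt a l b →
      K.boundary₁ (chainOfWord l) = Finsupp.single b (1 : ℤ) - Finsupp.single a (1 : ℤ) := by
    intro l
    induction l with
    | nil =>
      intro a b h
      simp only [IsEdgePath] at h
      subst h
      simp [chainOfWord]
    | cons p l ih =>
      intro a b h
      obtain ⟨e, s⟩ := p
      have hc : chainOfWord ((e, s) :: l) =
          Finsupp.single e (if s then (1 : ℤ) else -1) + chainOfWord l := by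
        simp [chainOfWord]
      rw [hc, map_add]
      cases s with
      | true =>
        obtain ⟨rfl, h⟩ := h
        rw [ih _ _ h]
        simp [boundary₁, Finsupp.linearCombination_single]
      | false =>
        obtain ⟨rfl, h⟩ := h
        rw [ih _ _ h]
        simp [boundary₁, Finsupp.linearCombination_single]
  refine Finsupp.lhom_ext' fun c => LinearMap.ext_ring ?_
  simp [boundary₂, Finsupp.linearCombination_single, key _ _ _ (K.bdry_closed c)]

/-- The second (cellular) homology group with integer coefficients. There are no 3-cells, so
it is the group of 2-cycles. -/
noncomputable def secondHomology (K : TwoComplex.{v}) : Submodule ℤ (K.Face →₀ ℤ) :=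
  LinearMap.ker K.boundary₂

/-- A covering `L → K` of two-dimensional complexes. The orientations of the edges of `L` and the
starting points and directions of the boundary paths of its 2-cells are those lifted from `K`. -/
structure Covering (L K : TwoComplex.{v}) where
  /-- The map on vertices. -/
  onVertex : L.Vertex → K.Vertex
  /-- The map on edges. -/
  onEdge : L.Edge → K.Edge
  /-- The map on 2-cells. -/
  onFace : L.Face → K.Face
  map_src : ∀ e, K.src (onEdge e) = onVertex (L.src e)
  map_tgt : ∀ e, K.tgt (onEdge e) = onVertex (L.tgt e)
  map_base : ∀ c, K.base (onFace c) = onVertex (L.base c)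
  map_bdry : ∀ c, K.bdry (onFace c) = (L.bdry c).map (fun p => (onEdge p.1, p.2))
  surjective : Function.Surjective onVertex
  /-- An edge going out of the image of `a` has a unique lift going out of `a`. -/
  lift_src : ∀ a e, K.src e = onVertex a → ∃! e', onEdge e' = e ∧ L.src e' = a
  /-- An edge coming into the image of `a` has a unique lift coming into `a`. -/
  lift_tgt : ∀ a e, K.tgt e = onVertex a → ∃! e', onEdge e' = e ∧ L.tgt e' = a
  /-- A 2-cell whose boundary path starts at the image of `a` has a unique lift whose boundary
  path starts at `a`. -/
  lift_base : ∀ a c, K.base c = onVertex a → ∃! c', onFace c' = c ∧ L.base c' = a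

end TwoComplex

open Classical in
/-- The standard complex of the presentation `⟨X | R⟩`: one vertex, an edge for each generator
and, for each relator, a 2-cell glued along the (reduced) word of this relator. -/
noncomputable def standardComplex {X I : Type v} (R : I → FreeGroup X) : TwoComplex.{v} where
  Vertex := PUnit
  Edge := X
  Face := I
  src := fun _ => PUnit.unit
  tgt := fun _ => PUnit.unit
  base := fun _ => PUnit.unit
  bdry := fun i => (R i).toWord
  bdry_closed := by
    intro i
    show IsEdgePath _ _ _ (R i).toWord _
    induction (R i).toWord with
    | nil => rfl
    | cons a l ih =>
      obtain ⟨x, b⟩ := a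
      cases b <;> exact ⟨rfl, ih⟩

/-!
Write `R` for the family of the contents of the equations. There are no 3-cells, so the second
homology of a complex vanishes if and only if the boundary chains of its 2-cells are linearly
independent (`TwoComplex.secondHomology_eq_bot_iff`). Everything rests on one device: given
permutations of a set `V` indexed by `X`, with labels in a group `A`, the free group `F(X)` acts
from the right on `V × A`, moving the point of `V` and collecting the labels on its way
(`freeTransport`). With coefficients in `G` acting by right multiplication this extends to
`G * F(X)` (`transport`). It is natural in the labels, and for suitable labels it computes lifts
of paths, their chains, and the Schreier rewriting process.

*From a Schreier presentation to a covering.* For a Schreier system `T`, the right cosets form the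
vertices of a connected covering with edges `T × X` and 2-cells `T × I`
(`SchreierSystem.coveringComplex`). Sending each edge to the row of its letter is a linear map
taking the boundary of the 2-cell `(t, i)` to the row of the relator `(t, i)`. Hence independent
rows come from independent boundaries.

*From a covering to a Schreier presentation.* The words whose lifts at a vertex `a` of the
covering are closed form a subgroup containing the normal closure of the relators, and it has a
Schreier system (`SchreierSystem.nonempty`). Sending the generator `(t, x)` to the chain of its
loop at `a` takes the row of the relator `(t, i)` to the boundary of a 2-cell, and distinct pairs
give distinct 2-cells (`TwoComplex.Covering.nonsingular_rewrite`). So independent boundaries come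
from independent rows. Connectedness plays no role here, as only one component is seen.

*Solvability.* Given a covering `L` with trivial second homology, lift each equation to the 2-cells
above it, keeping the coefficients and replacing the unknowns by the edges traversed. The rows of
this system are the boundaries of the 2-cells, so it is nonsingular and has a solution in some
`H ⊇ G`. This solution, read as a labelling of the edges, gives a solution of the original system
in the group of permutations of `L.Vertex × H`, in which `G` embeds diagonally
(`solvableOver_of_covering`).
-/

/-! ### Labelled permutation actions -/

section Transport

open MulOpposite

variable {V V' A A' X G : Type*} [Group A] [Group A'] [Group G]

/-- The action of the free group `F(X)` on `V × A` from the right, given by permutations `σ x` of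
`V` with labels `b v x`: the letter `x` sends `(v, h)` to `(σ x v, h * b v x)`. Thus a word moves
the point of `V` along its path and multiplies `h` by the labels read off along that path. Right
actions are encoded as homomorphisms to the opposite of the permutation group. -/
def freeTransport (σ : X → Equiv.Perm V) (b : V → X → A) :
    FreeGroup X →* (Equiv.Perm (V × A))ᵐᵒᵖ :=
  FreeGroup.lift fun x => op (Equiv.prodShear (σ x) fun v => Equiv.mulRight (b v x))

/-- The action of `A` on the second factor of `V × A` by right multiplication, as an element of
the opposite permutation group, pulled back along `a : G →* A`. -/
def diagonalAction (V : Type*) (a : G →* A) : G →* (Equiv.Perm (V × A))ᵐᵒᵖ where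
  toFun g := op (Equiv.prodShear (Equiv.refl V) fun _ => Equiv.mulRight (a g))
  map_one' := by
    apply unop_injective
    ext p <;> simp
  map_mul' g g' := by
    apply unop_injective
    ext p <;> simp [mul_assoc]

/-- The extension of `freeTransport` to `G * F(X)`, where the coefficient group `G` acts through
`a : G →* A` by right multiplication. -/
def transport (a : G →* A) (σ : X → Equiv.Perm V) (b : V → X → A) :
    Monoid.Coprod G (FreeGroup X) →* (Equiv.Perm (V × A))ᵐᵒᵖ :=
  Monoid.Coprod.lift (diagonalAction V a) (freeTransport σ b)

@[simp]
theorem diagonalAction_apply (a : G →* A) (g : G) (p : V × A) :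
    (diagonalAction V a g).unop p = (p.1, p.2 * a g) := rfl

@[simp]
theorem freeTransport_of (σ : X → Equiv.Perm V) (b : V → X → A) (x : X) (p : V × A) :
    (freeTransport σ b (FreeGroup.of x)).unop p = (σ x p.1, p.2 * b p.1 x) := by
  simp [freeTransport]

@[simp]
theorem freeTransport_of_inv (σ : X → Equiv.Perm V) (b : V → X → A) (x : X) (p : V × A) :
    (freeTransport σ b (FreeGroup.of x)⁻¹).unop p =
      ((σ x).symm p.1, p.2 * (b ((σ x).symm p.1) x)⁻¹) := by
  rw [map_inv, unop_inv, Equiv.Perm.inv_eq_iff_eq]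
  simp

theorem freeTransport_mul (σ : X → Equiv.Perm V) (b : V → X → A) (g h : FreeGroup X)
    (p : V × A) :
    (freeTransport σ b (g * h)).unop p =
      (freeTransport σ b h).unop ((freeTransport σ b g).unop p) := by
  simp

theorem transport_inl (a : G →* A) (σ : X → Equiv.Perm V) (b : V → X → A) (g : G) :
    transport a σ b (Monoid.Coprod.inl g) = diagonalAction V a g :=
  Monoid.Coprod.lift_apply_inl _ _ _

theorem transport_inr (a : G →* A) (σ : X → Equiv.Perm V) (b : V → X → A) (g : FreeGroup X) :
    transport a σ b (Monoid.Coprod.inr g) = freeTransport σ b g :=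
  Monoid.Coprod.lift_apply_inr _ _ _

/-- A map which intertwines the actions of the letters intertwines the actions of all words. -/
theorem freeTransport_intertwine {σ : X → Equiv.Perm V} {b : V → X → A}
    {σ' : X → Equiv.Perm V'} {b' : V' → X → A'} (f : V × A → V' × A')
    (hf : ∀ x p, f (σ x p.1, p.2 * b p.1 x) = (σ' x (f p).1, (f p).2 * b' (f p).1 x))
    (g : FreeGroup X) (p : V × A) :
    f ((freeTransport σ b g).unop p) = (freeTransport σ' b' g).unop (f p) := by
  induction g using FreeGroup.induction_on generalizing p with
  | C1 => simp
  | of x => simpa using hf x p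
  | inv_of x _ =>
    rw [map_inv (freeTransport σ' b'), unop_inv, Equiv.Perm.eq_inv_iff_eq,
      freeTransport_of, ← hf, freeTransport_of_inv]
    simp
  | mul g h hg hh => rw [freeTransport_mul, freeTransport_mul, hh, hg]

/-- Transport is natural in the group of labels and commutes with left multiplication. -/
theorem transport_map (a : G →* A) (σ : X → Equiv.Perm V) (b : V → X → A) (θ : A →* A') (k : A')
    (z : Monoid.Coprod G (FreeGroup X)) (p : V × A) :
    (transport (θ.comp a) σ (fun v x => θ (b v x)) z).unop (p.1, k * θ p.2) =
      (((transport a σ b z).unop p).1, k * θ ((transport a σ b z).unop p).2) := by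
  induction z using Monoid.Coprod.induction_on generalizing p with
  | inl g => simp [transport_inl, mul_assoc]
  | inr g =>
    simp only [transport_inr]
    exact (freeTransport_intertwine (fun p : V × A => (p.1, k * θ p.2))
      (by intros; simp [mul_assoc]) g p).symm
  | mul y z hy hz => simp only [map_mul, unop_mul, Equiv.Perm.mul_apply, hy, hz]

/-- If the coefficients act trivially, then transport depends on the content only. -/
theorem transport_one {G : Type u} [Group G] {X : Type v} (σ : X → Equiv.Perm V) (b : V → X → A)
    (z : Monoid.Coprod G (FreeGroup X)) :
    transport (1 : G →* A) σ b z = freeTransport σ b (content G X z) := by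
  suffices h : transport (1 : G →* A) σ b = (freeTransport σ b).comp (content G X) from
    DFunLike.congr_fun h z
  refine Monoid.Coprod.hom_ext (MonoidHom.ext fun g => ?_) (MonoidHom.ext fun g => ?_)
  · apply unop_injective
    ext p <;> simp [transport_inl, content]
  · simp [transport_inr, content]

theorem freeTransport_mul_left (σ : X → Equiv.Perm V) (b : V → X → A) (k : A)
    (g : FreeGroup X) (v : V) (h : A) :
    (freeTransport σ b g).unop (v, k * h) =
      (((freeTransport σ b g).unop (v, h)).1, k * ((freeTransport σ b g).unop (v, h)).2) :=
  (freeTransport_intertwine (fun p : V × A => (p.1, k * p.2))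
    (by intros; simp [mul_assoc]) g (v, h)).symm

/-- With commutative labels, going along a path, around a loop at its end, and back again has the
same total label as the loop alone. -/
theorem freeTransport_conj {A : Type*} [CommGroup A] (σ : X → Equiv.Perm V) (b : V → X → A)
    {t r : FreeGroup X} {v₀ v : V} {p q : A} (ht : (freeTransport σ b t).unop (v₀, 1) = (v, p))
    (hr : (freeTransport σ b r).unop (v, 1) = (v, q)) :
    (freeTransport σ b (t * r * t⁻¹)).unop (v₀, 1) = (v₀, q) := by
  have hr' : (freeTransport σ b r).unop (v, p) = (v, q * p) := by
    simpa [hr, mul_comm] using freeTransport_mul_left σ b p r v 1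
  rw [freeTransport_mul, freeTransport_mul, ht, hr', map_inv, unop_inv, Equiv.Perm.inv_eq_iff_eq]
  simpa [ht] using (freeTransport_mul_left σ b q t v₀ 1).symm

end Transport

/-! ### Existence of Schreier systems -/

theorem List.Shortlex.append_append {α : Type*} {r : α → α → Prop} {s t : List α}
    (h : List.Shortlex r s t) (q : List α) : List.Shortlex r (s ++ q) (t ++ q) := by
  rcases List.shortlex_def.mp h with h | ⟨h', hl⟩
  · exact .of_length_lt (by simpa using h)
  · refine .of_lex (by simpa using h') ?_
    clear h
    induction hl with
    | nil => simp at h'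
    | cons _ ih => exact .cons (ih (by simpa using h'))
    | rel h => exact .rel h

/-- Schreier systems exist: well-order the letters and represent each coset by the shortlex-least
word in it. Shortlex-least words are reduced, and prefixes of them are shortlex-least again. -/
theorem SchreierSystem.nonempty {X : Type v} (N : Subgroup (FreeGroup X)) :
    Nonempty (SchreierSystem N) := by
  classical
  let r : X × Bool → X × Bool → Prop := WellOrderingRel
  have hwf : WellFounded (List.Shortlex r) := List.Shortlex.wf WellOrderingRel.isWellOrder.wf
  -- the words representing elements of the coset `N g`
  let C : FreeGroup X → Set (List (X × Bool)) := fun g => {l | g * (FreeGroup.mk l)⁻¹ ∈ N}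
  have hC : ∀ g, (C g).Nonempty := fun g =>
    ⟨g.toWord, by simp [C, FreeGroup.mk_toWord, -FreeGroup.inv_mk]⟩
  let m : FreeGroup X → List (X × Bool) := fun g => hwf.min (C g) (hC g)
  have hm : ∀ g, g * (FreeGroup.mk (m g))⁻¹ ∈ N := fun g => hwf.min_mem (C g) (hC g)
  have hCeq : ∀ g h, g * h⁻¹ ∈ N → C g = C h := by
    intro g h H
    ext l
    change g * _ ∈ N ↔ h * _ ∈ N
    rw [← N.mul_mem_cancel_left H (y := h * _)]
    simp [mul_assoc]
  have hmeq : ∀ g h, g * h⁻¹ ∈ N → m g = m h := by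
    intro g h H
    simp only [m, hCeq g h H]
  have hmin : ∀ g l, g * (FreeGroup.mk l)⁻¹ ∈ N → ¬ List.Shortlex r l (m g) :=
    fun g l hl => hwf.not_lt_min (C g) hl
  -- a word that is not reduced is longer than its reduction
  have hred : ∀ g, (FreeGroup.mk (m g)).toWord = m g := by
    intro g
    obtain ⟨n, hn⟩ := (FreeGroup.reduce.red (L := m g)).length
    rw [FreeGroup.toWord_mk]
    by_contra hne
    refine hmin g (FreeGroup.reduce (m g)) (by rw [FreeGroup.reduce.self]; exact hm g)
      (.of_length_lt ?_)
    refine lt_of_le_of_ne (by omega) fun h => hne ?_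
    exact (FreeGroup.reduce.red (L := m g)).sublist.eq_of_length h
  refine ⟨⟨Set.range fun g => FreeGroup.mk (m g), ?_, ?_⟩⟩
  · rw [Subgroup.isComplement_iff_existsUnique_mul_inv_mem]
    refine fun g => ⟨⟨_, g, rfl⟩, hm g, ?_⟩
    rintro ⟨_, h, rfl⟩ H
    have : m g = m h := by
      rw [hmeq g _ H, hmeq h _ (hm h)]
    simp [this]
  · rintro _ ⟨g, rfl⟩ l ⟨q, hq⟩
    rw [hred] at hq
    refine ⟨FreeGroup.mk l, ?_⟩
    refine congrArg FreeGroup.mk ?_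
    by_contra hne
    have hnl : ¬ List.Shortlex r l (m (FreeGroup.mk l)) := hmin _ l (by simp [-FreeGroup.inv_mk])
    have hlt : List.Shortlex r (m (FreeGroup.mk l)) l := by
      have := (inferInstance : IsWellOrder _ (r : X × Bool → X × Bool → Prop))
      rcases trichotomous_of (List.Shortlex r) (m (FreeGroup.mk l)) l with h | h | h
      · exact h
      · exact absurd h hne
      · exact absurd h hnl
    -- replacing the prefix `l` by a smaller word in its coset stays in the coset `N g`
    refine hmin g (m (FreeGroup.mk l) ++ q) ?_ (by rw [← hq]; exact hlt.append_append q)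
    have h1 := hm g
    rw [← hq, ← FreeGroup.mul_mk] at h1
    rw [← FreeGroup.mul_mk]
    have h2 := N.mul_mem h1 (hm (FreeGroup.mk l))
    simpa [mul_assoc, -FreeGroup.inv_mk, -FreeGroup.mul_mk] using h2

/-! ### Exponent sums and chains -/

theorem exponentSums_one {X : Type v} : exponentSums (1 : FreeGroup X) = 0 := by
  simp [exponentSums]

theorem exponentSums_mul {X : Type v} (g h : FreeGroup X) :
    exponentSums (g * h) = exponentSums g + exponentSums h := by
  simp [exponentSums]

theorem exponentSums_inv {X : Type v} (g : FreeGroup X) :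
    exponentSums g⁻¹ = -exponentSums g := by
  simp [exponentSums]

/-- A homomorphism from a free group to an abelian group factors through the exponent sums. -/
theorem linearCombination_exponentSums {X : Type v} {B : Type*} [AddCommGroup B] (ψ : X → B)
    (r : FreeGroup X) :
    Finsupp.linearCombination ℤ ψ (exponentSums r) =
      (FreeGroup.lift (fun x => Multiplicative.ofAdd (ψ x)) r).toAdd := by
  induction r using FreeGroup.induction_on with
  | C1 => simp [exponentSums_one]
  | of x => simp [exponentSums]
  | inv_of x h => simp [exponentSums_inv, h]
  | mul g h hg hh => simp [exponentSums_mul, hg, hh]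

theorem TwoComplex.chainOfWord_cons {E : Type v} (e : E) (s : Bool) (l : List (E × Bool)) :
    chainOfWord ((e, s) :: l) = Finsupp.single e (if s then (1 : ℤ) else -1) + chainOfWord l := by
  simp [chainOfWord]

theorem TwoComplex.secondHomology_eq_bot_iff (K : TwoComplex.{v}) :
    K.secondHomology = ⊥ ↔ LinearIndependent ℤ fun c => chainOfWord (K.bdry c) :=
  LinearMap.ker_eq_bot

/-! ### Transport in a covering of the standard complex -/

namespace TwoComplex.Covering

open MulOpposite

variable {X I : Type v} {R : I → FreeGroup X} {L : TwoComplex.{v}}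
  (π : L.Covering (standardComplex R))

/-- The generator in `X` below an edge of the covering. -/
def generator (e : L.Edge) : X := π.onEdge e

/-- The lift starting at `a` of the edge `x` of the standard complex. -/
noncomputable def edge (a : L.Vertex) (x : X) : L.Edge :=
  (π.lift_src a x rfl).choose

/-- The lift ending at `a` of the edge `x` of the standard complex. -/
noncomputable def edgeTo (a : L.Vertex) (x : X) : L.Edge :=
  (π.lift_tgt a x rfl).choose

theorem generator_edge (a : L.Vertex) (x : X) : π.generator (π.edge a x) = x :=
  (π.lift_src a x rfl).choose_spec.1.1

theorem src_edge (a : L.Vertex) (x : X) : L.src (π.edge a x) = a :=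
  (π.lift_src a x rfl).choose_spec.1.2

theorem edge_src (e : L.Edge) : π.edge (L.src e) (π.generator e) = e :=
  ((π.lift_src (L.src e) (π.onEdge e) rfl).choose_spec.2 e ⟨rfl, rfl⟩).symm

theorem generator_edgeTo (a : L.Vertex) (x : X) : π.generator (π.edgeTo a x) = x :=
  (π.lift_tgt a x rfl).choose_spec.1.1

theorem tgt_edgeTo (a : L.Vertex) (x : X) : L.tgt (π.edgeTo a x) = a :=
  (π.lift_tgt a x rfl).choose_spec.1.2

theorem edgeTo_tgt (e : L.Edge) : π.edgeTo (L.tgt e) (π.generator e) = e :=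
  ((π.lift_tgt (L.tgt e) (π.onEdge e) rfl).choose_spec.2 e ⟨rfl, rfl⟩).symm

/-- The permutation of the vertices of a covering which moves each vertex along the edge over `x`
starting there. -/
noncomputable def perm (x : X) : Equiv.Perm L.Vertex where
  toFun a := L.tgt (π.edge a x)
  invFun a := L.src (π.edgeTo a x)
  left_inv a := by
    have h := π.edgeTo_tgt (π.edge a x)
    rw [generator_edge] at h
    simp only [h, src_edge]
  right_inv a := by
    have h := π.edge_src (π.edgeTo a x)
    rw [generator_edgeTo] at h
    simp only [h, tgt_edgeTo]

theorem perm_src (e : L.Edge) : π.perm (π.generator e) (L.src e) = L.tgt e :=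
  congrArg L.tgt (π.edge_src e)

theorem perm_symm_tgt (e : L.Edge) : (π.perm (π.generator e)).symm (L.tgt e) = L.src e :=
  (Equiv.symm_apply_eq _).mpr (π.perm_src e).symm

/-- Transport in a covering, where the labels record the edges: the word `g` sends `(v, c)` to
the end of the lift of `g` at `v`, together with the sum of `c` and the chain of this lift. -/
noncomputable def chainTransport :
    FreeGroup X →* (Equiv.Perm (L.Vertex × Multiplicative (L.Edge →₀ ℤ)))ᵐᵒᵖ :=
  freeTransport π.perm fun a x => Multiplicative.ofAdd (Finsupp.single (π.edge a x) 1)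

theorem chainTransport_path {l : List (L.Edge × Bool)} {a b : L.Vertex}
    (h : IsEdgePath L.src L.tgt a l b) (c : L.Edge →₀ ℤ) :
    (π.chainTransport (FreeGroup.mk (l.map fun p => (π.generator p.1, p.2)))).unop
      (a, Multiplicative.ofAdd c) = (b, Multiplicative.ofAdd (c + chainOfWord l)) := by
  induction l generalizing a c with
  | nil =>
    obtain rfl : a = b := h
    simp [← FreeGroup.one_eq_mk, chainOfWord]
  | cons p l ih =>
    obtain ⟨e, s⟩ := p
    have hcons (y : X) (m : List (X × Bool)) :
        FreeGroup.mk ((y, s) :: m) = FreeGroup.mk [(y, s)] * FreeGroup.mk m := by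
      simp
    rw [List.map_cons, hcons, chainTransport, freeTransport_mul, ← chainTransport,
      chainOfWord_cons, ← add_assoc]
    cases s with
    | true =>
      obtain ⟨rfl, h⟩ := h
      rw [← ih h]
      congr 1
      refine (freeTransport_of _ _ _ _).trans ?_
      rw [perm_src, edge_src]
      rfl
    | false =>
      obtain ⟨rfl, h⟩ := h
      rw [← ih h]
      congr 1
      have h1 := freeTransport_of_inv π.perm
        (fun a x => Multiplicative.ofAdd (Finsupp.single (π.edge a x) (1 : ℤ))) (π.generator e)
        (L.tgt e, Multiplicative.ofAdd c)
      simp only [perm_symm_tgt, edge_src] at h1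
      refine h1.trans ?_
      simp [ofAdd_add, ofAdd_neg]

/-- Transport along a relator goes around the boundary of a 2-cell. -/
theorem chainTransport_relator (c : L.Face) :
    (π.chainTransport (R (π.onFace c))).unop (L.base c, 1) =
      (L.base c, Multiplicative.ofAdd (chainOfWord (L.bdry c))) := by
  classical
  have h := π.chainTransport_path (L.bdry_closed c) 0
  have h2 : FreeGroup.mk ((L.bdry c).map fun p => (π.generator p.1, p.2)) = R (π.onFace c) := by
    exact (congrArg FreeGroup.mk (π.map_bdry c)).symm.trans FreeGroup.mk_toWord
  rw [h2] at h
  simpa using h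

theorem exists_face (a : L.Vertex) (i : I) : ∃ c, π.onFace c = i ∧ L.base c = a :=
  (π.lift_base a i rfl).exists

end TwoComplex.Covering

/-! ### Solving equations in a wreath product -/

section Solve

open MulOpposite

variable {G : Type u} [Group G] {X I : Type v} {w : EqSystem G X I} {L : TwoComplex.{v}}

/-- The system of equations over `G` read off from a covering of the standard complex: the
unknowns are the edges of the covering, and the equation of a 2-cell is the lift of the equation
below it, the coefficients being kept. -/
noncomputable def liftedSystem
    (π : L.Covering (standardComplex fun i => content G X (w i))) :
    EqSystem G L.Edge L.Face :=
  fun c => ((transport Monoid.Coprod.inl π.perm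
    (fun a x => Monoid.Coprod.inr (FreeGroup.of (π.edge a x))) (w (π.onFace c))).unop
      (L.base c, 1)).2

/-- The equation of a 2-cell has the boundary of the 2-cell as its row of exponent sums, and it
comes from a closed path. -/
theorem transport_liftedSystem (π : L.Covering (standardComplex fun i => content G X (w i)))
    (c : L.Face) :
    ((transport (Monoid.Coprod.inl : G →* Monoid.Coprod G (FreeGroup L.Edge)) π.perm
      (fun a x => Monoid.Coprod.inr (FreeGroup.of (π.edge a x))) (w (π.onFace c))).unop
        (L.base c, 1)).1 = L.base c ∧
    exponentSums (content G L.Edge (liftedSystem π c)) = TwoComplex.chainOfWord (L.bdry c) := by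
  -- push the labels forward along the map from `G * F(L.Edge)` to the abelianization of `F(L.Edge)`
  have h := transport_map (Monoid.Coprod.inl : G →* Monoid.Coprod G (FreeGroup L.Edge)) π.perm
    (fun a x => Monoid.Coprod.inr (FreeGroup.of (π.edge a x)))
    ((FreeGroup.lift fun e : L.Edge => Multiplicative.ofAdd (Finsupp.single e (1 : ℤ))).comp
      (content G L.Edge)) 1 (w (π.onFace c)) (L.base c, 1)
  have h1 : ((FreeGroup.lift fun e : L.Edge => Multiplicative.ofAdd
      (Finsupp.single e (1 : ℤ))).comp (content G L.Edge)).comp Monoid.Coprod.inl = 1 := by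
    ext g
    simp [content]
  rw [h1, transport_one] at h
  have h2 := π.chainTransport_relator c
  simp only [TwoComplex.Covering.chainTransport] at h2
  simp only [content, MonoidHom.comp_apply, Monoid.Coprod.lift_apply_inr, MonoidHom.id_apply,
    FreeGroup.lift_apply_of, map_one, mul_one, one_mul] at h h2
  have h3 := h.symm.trans h2
  exact ⟨congrArg Prod.fst h3, congrArg Prod.snd h3⟩

/-- A covering with trivial second homology makes the lifted system nonsingular. A solution `s`
of it in `H ⊇ G` gives a solution of the original system in the permutations of
`L.Vertex × H`, where `G` acts diagonally and an unknown moves along the edges above it. -/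
theorem solvableOver_of_covering (hG : IsGRGroup.{u, v} G)
    (π : L.Covering (standardComplex fun i => content G X (w i))) (hL : L.secondHomology = ⊥) :
    w.SolvableOver := by
  have hns : (liftedSystem π).Nonsingular := by
    unfold EqSystem.Nonsingular NonsingularFamily
    simp only [(transport_liftedSystem π _).2]
    exact L.secondHomology_eq_bot_iff.mp hL
  obtain ⟨H, _, φ, s, hφ, hs⟩ := hG _ _ _ hns
  refine ⟨(Equiv.Perm (L.Vertex × H))ᵐᵒᵖ, inferInstance, diagonalAction L.Vertex φ,
    fun x => freeTransport π.perm (fun a x => s (π.edge a x)) (FreeGroup.of x), ?_, ?_⟩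
  · intro g g' h
    obtain ⟨a, -⟩ := π.surjective PUnit.unit
    have := congrArg (fun p => (p.unop (a, 1)).2) h
    exact hφ (by simpa using this)
  · intro i
    have hlift : FreeGroup.lift (fun x => freeTransport π.perm (fun a x => s (π.edge a x))
        (FreeGroup.of x)) = freeTransport π.perm (fun a x => s (π.edge a x)) :=
      FreeGroup.ext_hom _ _ fun x => FreeGroup.lift_apply_of
    rw [hlift]
    change transport φ π.perm (fun a x => s (π.edge a x)) (w i) = 1
    apply unop_injective
    refine Equiv.ext fun ⟨a, k⟩ => ?_
    obtain ⟨c, rfl, rfl⟩ := π.exists_face a i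
    have h := transport_map (Monoid.Coprod.inl : G →* Monoid.Coprod G (FreeGroup L.Edge)) π.perm
      (fun a x => Monoid.Coprod.inr (FreeGroup.of (π.edge a x)))
      (Monoid.Coprod.lift φ (FreeGroup.lift s)) k (w (π.onFace c)) (L.base c, 1)
    have hc := hs c
    simp only [liftedSystem] at hc
    rw [hc, (transport_liftedSystem π c).1] at h
    simpa using h

end Solve

/-! ### Schreier rewriting as transport -/

namespace SchreierSystem

open MulOpposite

variable {X I : Type v} {N : Subgroup (FreeGroup X)} (T : SchreierSystem N)

/-- The right action of a letter on the representatives of the right cosets of `N`. -/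
noncomputable def perm (x : X) : Equiv.Perm T.carrier where
  toFun t := T.rep (t * FreeGroup.of x)
  invFun t := T.rep (t * (FreeGroup.of x)⁻¹)
  left_inv t := by simp [T.rep_rep_mul, T.rep_coe]
  right_inv t := by simp [T.rep_rep_mul, T.rep_coe]

theorem perm_apply (x : X) (t : T.carrier) : T.perm x t = T.rep (t * FreeGroup.of x) := rfl

theorem perm_symm_apply (x : X) (t : T.carrier) :
    (T.perm x).symm t = T.rep (t * (FreeGroup.of x)⁻¹) := rfl

theorem rep_one : (T.rep 1 : FreeGroup X) = 1 :=
  congrArg Subtype.val (T.rep_coe ⟨1, T.one_mem⟩)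

/-- Transport with the letters of the Schreier presentation as labels is the rewriting process.
In particular rewriting does not depend on the word chosen for an element of `F(X)`. -/
theorem freeTransport_mk (l : List (X × Bool)) (t : T.carrier) (h : FreeGroup T.Gen) :
    (freeTransport T.perm (fun t x => T.letter (t, x)) (FreeGroup.mk l)).unop (t, h) =
      (T.rep (t * FreeGroup.mk l), h * T.rewriteFrom t l) := by
  induction l generalizing t h with
  | nil => simp [← FreeGroup.one_eq_mk, rewriteFrom, T.rep_coe]
  | cons p l ih =>
    obtain ⟨x, s⟩ := p
    have hcons : FreeGroup.mk ((x, s) :: l) = FreeGroup.mk [(x, s)] * FreeGroup.mk l := by simp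
    rw [hcons, freeTransport_mul]
    cases s with
    | true =>
      rw [show FreeGroup.mk [(x, true)] = FreeGroup.of x from rfl, freeTransport_of, ih,
        perm_apply, rep_rep_mul, rewriteFrom, mul_assoc, mul_assoc]
    | false =>
      rw [show FreeGroup.mk [(x, false)] = (FreeGroup.of x)⁻¹ from rfl, freeTransport_of_inv, ih,
        perm_symm_apply, rep_rep_mul, rewriteFrom, mul_assoc, mul_assoc]

theorem freeTransport_rewrite {g : FreeGroup X} (hg : g ∈ N) :
    (freeTransport T.perm (fun t x => T.letter (t, x)) g).unop (T.rep 1, 1) =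
      (T.rep 1, T.rewrite g) := by
  classical
  have h := T.freeTransport_mk g.toWord (T.rep 1) 1
  rw [FreeGroup.mk_toWord, rep_rep_mul, one_mul, one_mul,
    T.rep_eq_of_mul_inv_mem (g := g) (h := 1) (by simpa using hg)] at h
  rw [h, rewrite]

/-- In abelianized form, rewriting `t * r * t⁻¹` amounts to rewriting `r` from `t` on. -/
theorem exponentSums_rewrite_conj (t : T.carrier) {r : FreeGroup X} {l : List (X × Bool)}
    (hl : FreeGroup.mk l = r) (hr : t * r * (t : FreeGroup X)⁻¹ ∈ N) :
    exponentSums (T.rewrite (t * r * (t : FreeGroup X)⁻¹)) =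
      exponentSums (T.rewriteFrom t l) := by
  classical
  let θ : FreeGroup T.Gen →* Multiplicative (T.Gen →₀ ℤ) :=
    FreeGroup.lift fun y => Multiplicative.ofAdd (Finsupp.single y (1 : ℤ))
  have key (g : FreeGroup X) (s : T.carrier) (h : FreeGroup T.Gen) :=
    freeTransport_intertwine (σ := T.perm) (b := fun t x => T.letter (t, x)) (σ' := T.perm)
      (b' := fun t x => θ (T.letter (t, x)))
      (fun p : T.carrier × FreeGroup T.Gen => (p.1, θ p.2)) (by intros; simp) g (s, h)
  have h1 := key t (T.rep 1) 1
  have h2 := key r t 1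
  have h3 := key (t * r * (t : FreeGroup X)⁻¹) (T.rep 1) 1
  rw [T.freeTransport_rewrite hr] at h3
  rw [← hl, T.freeTransport_mk, hl, T.rep_eq_of_mul_inv_mem hr, T.rep_coe] at h2
  rw [← FreeGroup.mk_toWord (x := (t : FreeGroup X)), T.freeTransport_mk, FreeGroup.mk_toWord,
    rep_rep_mul, one_mul, T.rep_coe] at h1
  simp only [map_one, one_mul] at h1 h2 h3
  rw [freeTransport_conj _ _ h1.symm h2.symm] at h3
  exact congrArg (fun p => p.2.toAdd) h3

end SchreierSystem

/-! ### From Schreier presentations to coverings -/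

namespace SchreierSystem

open TwoComplex

variable {X I : Type v} {N : Subgroup (FreeGroup X)} (T : SchreierSystem N)

/-- The source of the edge `(t, x)` of the Schreier graph. -/
def graphSrc (e : T.carrier × X) : T.carrier := e.1

/-- The end of the edge `(t, x)` of the Schreier graph. -/
noncomputable def graphTgt (e : T.carrier × X) : T.carrier := T.rep (e.1 * FreeGroup.of e.2)

/-- The lift at `t` of a word to the Schreier graph of the right cosets of `N`. -/
noncomputable def liftPath : T.carrier → List (X × Bool) → List ((T.carrier × X) × Bool)
  | _, [] => []
  | t, (x, true) :: l => ((t, x), true) :: liftPath (T.rep (t * FreeGroup.of x)) l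
  | t, (x, false) :: l =>
      ((T.rep (t * (FreeGroup.of x)⁻¹), x), false) ::
        liftPath (T.rep (t * (FreeGroup.of x)⁻¹)) l

theorem isEdgePath_liftPath (t : T.carrier) (l : List (X × Bool)) :
    IsEdgePath T.graphSrc T.graphTgt t (T.liftPath t l) (T.rep (t * FreeGroup.mk l)) := by
  induction l generalizing t with
  | nil => simp [← FreeGroup.one_eq_mk, liftPath, IsEdgePath, T.rep_coe]
  | cons p l ih =>
    obtain ⟨x, s⟩ := p
    have hcons : FreeGroup.mk ((x, s) :: l) = FreeGroup.mk [(x, s)] * FreeGroup.mk l := by simp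
    rw [hcons, ← mul_assoc, ← rep_rep_mul]
    cases s with
    | true => exact ⟨rfl, ih _⟩
    | false =>
      refine ⟨?_, ih _⟩
      simp [graphTgt, T.rep_rep_mul, T.rep_coe]

theorem map_liftPath (t : T.carrier) (l : List (X × Bool)) :
    (T.liftPath t l).map (fun p => (p.1.2, p.2)) = l := by
  induction l generalizing t with
  | nil => rfl
  | cons p l ih => obtain ⟨x, _ | _⟩ := p <;> simp [liftPath, ih]

theorem linearCombination_chainOfWord_liftPath (t : T.carrier) (l : List (X × Bool)) :
    Finsupp.linearCombination ℤ (fun e => exponentSums (T.letter e))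
      (chainOfWord (T.liftPath t l)) = exponentSums (T.rewriteFrom t l) := by
  induction l generalizing t with
  | nil => simp [liftPath, chainOfWord, rewriteFrom, exponentSums_one]
  | cons p l ih =>
    obtain ⟨x, _ | _⟩ := p <;>
      simp [liftPath, chainOfWord_cons, rewriteFrom, exponentSums_mul, exponentSums_inv, ih]

open Classical in
/-- The covering of the standard complex of `⟨X | R⟩` whose vertices are the right cosets of a
subgroup `N` which contains all the conjugates of the relators. -/
noncomputable def coveringComplex (R : I → FreeGroup X)
    (hR : ∀ (t : T.carrier) i, t * R i * (t : FreeGroup X)⁻¹ ∈ N) : TwoComplex.{v} where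
  Vertex := T.carrier
  Edge := T.carrier × X
  Face := T.carrier × I
  src := T.graphSrc
  tgt := T.graphTgt
  base c := c.1
  bdry c := T.liftPath c.1 (R c.2).toWord
  bdry_closed c := by
    have h := T.isEdgePath_liftPath c.1 (R c.2).toWord
    rwa [FreeGroup.mk_toWord, T.rep_eq_of_mul_inv_mem (hR c.1 c.2), T.rep_coe] at h

variable (R : I → FreeGroup X) (hR : ∀ (t : T.carrier) i, t * R i * (t : FreeGroup X)⁻¹ ∈ N)

/-- The projection of `coveringComplex` to the standard complex. -/
noncomputable def coveringComplexCovering :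
    (T.coveringComplex R hR).Covering (standardComplex R) where
  onVertex _ := PUnit.unit
  onEdge e := e.2
  onFace c := c.2
  map_src _ := rfl
  map_tgt _ := rfl
  map_base _ := rfl
  map_bdry c := (T.map_liftPath c.1 _).symm
  surjective _ := ⟨T.rep 1, rfl⟩
  lift_src t x _ := by
    refine ⟨(t, x), ⟨rfl, rfl⟩, ?_⟩
    rintro ⟨t', x'⟩ ⟨h, h'⟩
    exact Prod.ext h' h
  lift_tgt t x _ := by
    refine ⟨((T.perm x).symm t, x), ⟨rfl, (T.perm x).apply_symm_apply t⟩, ?_⟩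
    rintro ⟨t', x'⟩ ⟨h, h'⟩
    obtain rfl : x' = x := h
    exact Prod.ext ((Equiv.eq_symm_apply _).mpr h') rfl
  lift_base t i _ := by
    refine ⟨(t, i), ⟨rfl, rfl⟩, ?_⟩
    rintro ⟨t', i'⟩ ⟨h, h'⟩
    exact Prod.ext h' h

theorem connected_coveringComplex : (T.coveringComplex R hR).Connected := by
  classical
  refine ⟨⟨T.rep 1⟩, fun (a b : T.carrier) => ?_⟩
  have h := T.isEdgePath_liftPath a ((a : FreeGroup X)⁻¹ * b).toWord
  rw [FreeGroup.mk_toWord, mul_inv_cancel_left, T.rep_coe] at h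
  exact ⟨_, h⟩

/-- If the Schreier relators are nonsingular, then so are the boundaries of the 2-cells, since
sending each edge to the exponent sums of its letter takes the latter to the former. -/
theorem secondHomology_coveringComplex
    (hT : NonsingularFamily fun p : T.carrier × I =>
      T.rewrite (p.1 * R p.2 * (p.1 : FreeGroup X)⁻¹)) :
    (T.coveringComplex R hR).secondHomology = ⊥ := by
  classical
  rw [secondHomology_eq_bot_iff]
  refine LinearIndependent.of_comp
    (Finsupp.linearCombination ℤ fun e : T.carrier × X => exponentSums (T.letter e)) ?_
  change LinearIndependent ℤ fun p : T.carrier × I => Finsupp.linearCombination ℤ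
    (fun e => exponentSums (T.letter e)) (chainOfWord (T.liftPath p.1 (R p.2).toWord))
  have h (p : T.carrier × I) :=
    T.exponentSums_rewrite_conj p.1 (FreeGroup.mk_toWord (x := R p.2)) (hR p.1 p.2)
  simp only [NonsingularFamily, h] at hT
  simpa only [linearCombination_chainOfWord_liftPath] using hT

end SchreierSystem

/-! ### From coverings to Schreier presentations -/

namespace TwoComplex.Covering

open MulOpposite

variable {X I : Type v} {R : I → FreeGroup X} {L : TwoComplex.{v}}
  (π : L.Covering (standardComplex R))

/-- The end of the lift of the word `g` at the vertex `a`. -/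
noncomputable def act (a : L.Vertex) (g : FreeGroup X) : L.Vertex :=
  ((π.chainTransport g).unop (a, 1)).1

theorem fst_chainTransport (g : FreeGroup X) (p : L.Vertex × Multiplicative (L.Edge →₀ ℤ)) :
    ((π.chainTransport g).unop p).1 = π.act p.1 g := by
  have h := freeTransport_mul_left π.perm
    (fun a x => Multiplicative.ofAdd (Finsupp.single (π.edge a x) (1 : ℤ))) p.2 g p.1 1
  rw [mul_one p.2] at h
  have h' := congrArg Prod.fst h
  exact h'

theorem act_one (a : L.Vertex) : π.act a 1 = a := by simp [act]

theorem act_mul (a : L.Vertex) (g h : FreeGroup X) : π.act a (g * h) = π.act (π.act a g) h := by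
  rw [act, chainTransport, freeTransport_mul]
  exact π.fst_chainTransport h _

/-- The subgroup of `F(X)` of the words whose lifts at the vertex `a` are closed. -/
noncomputable def stabilizer (a : L.Vertex) : Subgroup (FreeGroup X) where
  carrier := {g | π.act a g = a}
  one_mem' := π.act_one a
  mul_mem' {g h} hg hh := by
    change π.act a (g * h) = a
    rw [act_mul, show π.act a g = a from hg, hh]
  inv_mem' {g} hg := by
    change π.act a g⁻¹ = a
    rw [← show π.act a g = a from hg, ← act_mul, mul_inv_cancel, act_one, hg]

theorem mem_stabilizer {a : L.Vertex} {g : FreeGroup X} :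
    g ∈ π.stabilizer a ↔ π.act a g = a := Iff.rfl

theorem act_relator (a : L.Vertex) (i : I) : π.act a (R i) = a := by
  obtain ⟨c, rfl, rfl⟩ := π.exists_face a i
  exact congrArg Prod.fst (π.chainTransport_relator c)

theorem act_of_mem_normalClosure {g : FreeGroup X}
    (hg : g ∈ Subgroup.normalClosure (Set.range R)) (a : L.Vertex) : π.act a g = a := by
  let K : Subgroup (FreeGroup X) := ⨅ b, π.stabilizer b
  have hK {h : FreeGroup X} : h ∈ K ↔ ∀ b, π.act b h = b := by
    simp [K, Subgroup.mem_iInf, mem_stabilizer]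
  have hn : K.Normal := ⟨fun h hh k => hK.mpr fun b => by
    rw [act_mul, act_mul, hK.mp hh, ← act_mul, mul_inv_cancel, act_one]⟩
  refine hK.mp (Subgroup.normalClosure_le_normal ?_ hg) a
  rintro _ ⟨i, rfl⟩
  exact hK.mpr fun b => π.act_relator b i

theorem comap_map_stabilizer (a : L.Vertex) :
    ((π.stabilizer a).map (PresentedGroup.mk (Set.range R))).comap
      (PresentedGroup.mk (Set.range R)) = π.stabilizer a := by
  refine Subgroup.comap_map_eq_self ?_
  intro g hg
  exact π.act_of_mem_normalClosure ((QuotientGroup.eq_one_iff g).mp hg) a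

/-- A Schreier system for the stabilizer of a vertex `a` in a covering with trivial second
homology has nonsingular relators. Let `D t` be the chain of the lift of `t` at `a`. Sending the
generator `(t, x)` to the chain `D t + e - D (rep (t * x))` of a loop, where `e` is the lift of
`x` at the end of the lift of `t`, takes the row of the relator `(t, i)` to the boundary of the
lift of the 2-cell `i` at the end of the lift of `t`. -/
theorem nonsingular_rewrite {N : Subgroup (FreeGroup X)} (T : SchreierSystem N) (a : L.Vertex)
    (hN : ∀ g, g ∈ N ↔ π.act a g = a) (hL : L.secondHomology = ⊥) :
    NonsingularFamily fun p : T.carrier × I =>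
      T.rewrite (p.1 * R p.2 * (p.1 : FreeGroup X)⁻¹) := by
  rw [secondHomology_eq_bot_iff] at hL
  let D (g : FreeGroup X) : Multiplicative (L.Edge →₀ ℤ) := ((π.chainTransport g).unop (a, 1)).2
  have hD (g : FreeGroup X) : (π.chainTransport g).unop (a, 1) = (π.act a g, D g) := rfl
  have hstep (g : FreeGroup X) (x : X) :
      π.act a (g * FreeGroup.of x) = π.perm x (π.act a g) ∧
      D (g * FreeGroup.of x) =
        D g * Multiplicative.ofAdd (Finsupp.single (π.edge (π.act a g) x) 1) := by
    have h : (π.chainTransport (g * FreeGroup.of x)).unop (a, 1) = _ :=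
      (freeTransport_mul _ _ _ _ _).trans (freeTransport_of _ _ _ _)
    exact ⟨congrArg Prod.fst h, congrArg Prod.snd h⟩
  have hrep (g : FreeGroup X) : π.act a (T.rep g) = π.act a g := by
    have h := T.mul_rep_inv_mem g
    rw [hN] at h
    conv_lhs => rw [← h]
    rw [← act_mul, inv_mul_cancel_right]
  let ψ (y : T.carrier × X) : Multiplicative (L.Edge →₀ ℤ) :=
    D y.1 * Multiplicative.ofAdd (Finsupp.single (π.edge (π.act a y.1) y.2) 1) *
      (D (T.rep (y.1 * FreeGroup.of y.2)))⁻¹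
  let Θ : FreeGroup T.Gen →* Multiplicative (L.Edge →₀ ℤ) := FreeGroup.lift fun y => ψ y.1
  have hΘ (y : T.carrier × X) : Θ (T.letter y) = ψ y := by
    unfold SchreierSystem.letter
    split_ifs with h
    · exact FreeGroup.lift_apply_of
    -- if the generator is trivial, then `t * x` is a representative and its loop has zero chain
    · rw [map_one]
      simp only [ψ]
      rw [← mul_inv_eq_one.mp (not_not.mp h), (hstep _ _).2, mul_inv_cancel]
  have hrow (p : T.carrier × I) (c : L.Face) (hb : L.base c = π.act a p.1)
      (hc : R (π.onFace c) = R p.2) :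
      Θ (T.rewrite (p.1 * R p.2 * (p.1 : FreeGroup X)⁻¹)) =
        Multiplicative.ofAdd (chainOfWord (L.bdry c)) := by
    have h1 := freeTransport_intertwine (σ := T.perm) (b := fun t x => T.letter (t, x))
      (σ' := π.perm)
      (b' := fun v x => Multiplicative.ofAdd (Finsupp.single (π.edge v x) (1 : ℤ)))
      (fun q : T.carrier × FreeGroup T.Gen => (π.act a q.1, Θ q.2 * D q.1)) (by
        intro x q
        refine Prod.ext ?_ ?_
        · simp only [SchreierSystem.perm_apply, hrep, hstep]
        · simp only [SchreierSystem.perm_apply, map_mul, hΘ, ψ]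
          rw [mul_assoc, inv_mul_cancel_right, mul_assoc])
      (p.1 * R p.2 * (p.1 : FreeGroup X)⁻¹) (T.rep 1, 1)
    have h2 := π.chainTransport_relator c
    rw [hc, hb] at h2
    have h3 := freeTransport_conj _ _ (hD p.1) h2
    have hmem : p.1 * R p.2 * (p.1 : FreeGroup X)⁻¹ ∈ N := by
      rw [hN]
      exact congrArg Prod.fst h3
    have hD1 : D 1 = 1 := by simp [D]
    rw [T.freeTransport_rewrite hmem] at h1
    simp only [T.rep_one, act_one, hD1, map_one, mul_one] at h1
    exact congrArg Prod.snd (h1.trans h3)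
  -- distinct cosets of the stabilizer give distinct vertices, hence distinct 2-cells
  choose F hF using fun p : T.carrier × I => π.exists_face (π.act a p.1) p.2
  have hFinj : Function.Injective F := by
    rintro ⟨t, i⟩ ⟨t', i'⟩ h
    have hi : i = i' :=
      (hF (t, i)).1.symm.trans ((congrArg π.onFace h).trans (hF (t', i')).1)
    have ht : π.act a t = π.act a t' :=
      (hF (t, i)).2.symm.trans ((congrArg L.base h).trans (hF (t', i')).2)
    have hmem : (t : FreeGroup X) * (t' : FreeGroup X)⁻¹ ∈ N := by
      rw [hN, act_mul, ht, ← act_mul, mul_inv_cancel, act_one]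
    have := T.rep_eq_of_mul_inv_mem hmem
    rw [T.rep_coe, T.rep_coe] at this
    rw [this, hi]
  refine LinearIndependent.of_comp (Finsupp.linearCombination ℤ fun y => (ψ y.1).toAdd) ?_
  convert hL.comp F hFinj using 1
  funext p
  have h := hrow p (F p) (hF p).2 (congrArg R (hF p).1)
  exact (linearCombination_exponentSums _ _).trans (congrArg Multiplicative.toAdd h)

end TwoComplex.Covering

/-! ### The equivalence and the solvability -/

theorem exists_connected_covering {X I : Type v} {R : I → FreeGroup X}
    (h : HasNonsingularSchreierPresentation R) :
    ∃ (L : TwoComplex.{v}) (_ : L.Covering (standardComplex R)),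
      L.Connected ∧ L.secondHomology = ⊥ := by
  obtain ⟨U, T, hT⟩ := h
  have hR (t : T.carrier) (i : I) : t * R i * (t : FreeGroup X)⁻¹ ∈
      U.comap (PresentedGroup.mk (Set.range R)) := by
    have : PresentedGroup.mk (Set.range R) (R i) = 1 :=
      PresentedGroup.one_of_mem (Set.mem_range_self i)
    rw [Subgroup.mem_comap, map_mul, map_mul, map_inv, this, mul_one, mul_inv_cancel]
    exact U.one_mem
  exact ⟨_, T.coveringComplexCovering R hR, T.connected_coveringComplex R hR,
    T.secondHomology_coveringComplex R hR hT⟩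

theorem hasNonsingularSchreierPresentation_of_covering {X I : Type v} {R : I → FreeGroup X}
    {L : TwoComplex.{v}} (π : L.Covering (standardComplex R)) (hL : L.secondHomology = ⊥) :
    HasNonsingularSchreierPresentation R := by
  obtain ⟨a, -⟩ := π.surjective PUnit.unit
  obtain ⟨T⟩ := SchreierSystem.nonempty (((π.stabilizer a).map
    (PresentedGroup.mk (Set.range R))).comap (PresentedGroup.mk (Set.range R)))
  exact ⟨_, T, π.nonsingular_rewrite T a
    (fun g => by rw [π.comap_map_stabilizer a, π.mem_stabilizer]) hL⟩

theorem mainTheorem4 {G : Type u} [Group G] {X I : Type v} (w : EqSystem G X I) :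
    -- with `R` the family of the contents of the equations,
    -- the conditions on the presentation `⟨X | R⟩` are equivalent
    List.TFAE
      [HasNonsingularSchreierPresentation (fun i => content G X (w i)),
        ∃ (L : TwoComplex.{v}) (_ : L.Covering (standardComplex (fun i => content G X (w i)))),
          L.secondHomology = ⊥,
        ∃ (L : TwoComplex.{v}) (_ : L.Covering (standardComplex (fun i => content G X (w i)))),
          L.Connected ∧ L.secondHomology = ⊥] ∧
    -- and each of them is sufficient for the solvability if `G` is a GR-group
    (IsGRGroup.{u, v} G →
      HasNonsingularSchreierPresentation (fun i => content G X (w i)) → w.SolvableOver) ∧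
    (IsGRGroup.{u, v} G →
      (∃ (L : TwoComplex.{v}) (_ : L.Covering (standardComplex (fun i => content G X (w i)))),
        L.secondHomology = ⊥) → w.SolvableOver) := by
  refine ⟨?_, ?_, ?_⟩
  · tfae_have 1 → 3 := exists_connected_covering
    tfae_have 3 → 2 := fun ⟨L, π, _, hL⟩ => ⟨L, π, hL⟩
    tfae_have 2 → 1 := fun ⟨L, π, hL⟩ => hasNonsingularSchreierPresentation_of_covering π hL
    tfae_finish
  · intro hG h
    obtain ⟨L, π, -, hL⟩ := exists_connected_covering h
    exact solvableOver_of_covering hG π hL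
  · rintro hG ⟨L, π, hL⟩
    exact solvableOver_of_covering hG π hL
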